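/- Let $m\geq 2$ and let $(x_n)_{n\geq 1}$ be a sequence in the Euclidean space $\mathbb R^m$. Write $S_\infty$ for the group of all permutations of $\mathbb N$. Let $\operatorname{SR}(\sum_{n=1}^\infty x_n)$, the sum range, be the set of all $s\in\mathbb R^m$ such that for some $\sigma\in S_\infty$ the partial sums $\sum_{n=1}^k x_{\sigma(n)}$ converge to $s$ as $k\to\infty$. For $\sigma\in S_\infty$ let $\operatorname{LIM}(\sum_{n=1}^\infty x_{\sigma(n)})$ be the set of all limit points of the sequence $\big(\sum_{n=1}^k x_{\sigma(n)}\big)_{k=1}^\infty$, that is, of all limits of its convergent subsequences. Assume that $\operatorname{SR}(\sum_{n=1}^\infty x_n)=\mathbb R^m$, and let $X\subseteq\mathbb R^m$ be a closed (possibly empty) set all of whose connected components are unbounded. Then there is $\sigma\in S_\infty$ such that $X=\operatorname{LIM}(\sum_{n=1}^\infty x_{\sigma(n)})$. -/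

import Mathlib

open Filter Topology

/-- The `k`-th partial sum `y 0 + ⋯ + y (k - 1)` of the series with terms `y n`. -/
def seriesPartialSum {E : Type*} [AddCommMonoid E] (y : ℕ → E) (k : ℕ) : E :=
  ∑ n ∈ Finset.range k, y n

/-- The sum range `SR(∑ x n)`: all sums of convergent rearrangements of the series
(convergence of the sequence of partial sums, not unconditional summability). -/
def sumRange {E : Type*} [AddCommMonoid E] [TopologicalSpace E] (x : ℕ → E) : Set E :=
  {s | ∃ σ : Equiv.Perm ℕ, Tendsto (seriesPartialSum fun n => x (σ n)) atTop (𝓝 s)}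

/-- The limit set `LIM(∑ y n)`: all limit (cluster) points of the sequence of partial sums. -/
def limitSet {E : Type*} [AddCommMonoid E] [TopologicalSpace E] (y : ℕ → E) : Set E :=
  {a | MapClusterPt a atTop (seriesPartialSum y)}

open scoped Finset List
open Module (finrank)

/-!
By the Steinitz lemma, a finite family of vectors of norm at most `ε` can be ordered so that its
partial sums have norm at most that of the total sum plus a multiple of `ε` depending only on the
dimension. Every point is a limit of sums over arbitrarily large finite sets of indices. Hence a
finite piece of a rearrangement which has used up all terms of norm exceeding `ε` and has sum close
to `p` can be continued, inside an `O(ε)`-neighbourhood of any `q` with `dist p q ≤ ε`, to a piece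
with sum as close to `q` as desired. Chaining such steps, the partial sums can travel between any
two points of a preconnected set without leaving an `O(ε)`-neighbourhood of it.

The sets `Y n = X ∪ {z | n ≤ ‖z‖}` are closed and connected and decrease to `X`. Let the partial
sums travel along `Y n` at scale `1 / (n + 1)`, visiting a dense sequence of points of `X`, each
infinitely often: then all points of `X` are limit points, and every limit point lies in each `Y n`.
-/

theorem exists_map_eq_zero_of_finrank_lt_card {K ι F : Type*} [Field K] [AddCommGroup F]
    [Module K F] [FiniteDimensional K F] (f : (ι → K) →ₗ[K] F) {T : Finset ι}
    (hT : finrank K F < #T) : ∃ h : ι → K, f h = 0 ∧ h ≠ 0 ∧ ∀ i ∉ T, h i = 0 := by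
  let extend := Function.ExtendByZero.linearMap K ((↑) : T → ι)
  obtain ⟨g, hg, hg0⟩ : ∃ g ∈ (f ∘ₗ extend).ker, g ≠ 0 :=
    Submodule.exists_mem_ne_zero_of_ne_bot (LinearMap.ker_ne_bot_of_finrank_lt (by simpa using hT))
  refine ⟨extend g, hg, fun h0 => hg0 (funext fun i => ?_), fun i hi => ?_⟩
  · exact (Subtype.val_injective.extend_apply g 0 i).symm.trans (congrFun h0 i)
  · exact Function.extend_apply' g (0 : ι → K) i fun ⟨j, hj⟩ => hi (hj ▸ j.2)

theorem eventually_add_smul_mem_Icc {ι : Type*} [Finite ι] {u h : ι → ℝ}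
    (hu : u ∈ Set.Icc 0 1) (hh : ∀ i, u i ∉ Set.Ioo (0 : ℝ) 1 → h i = 0) :
    ∀ᶠ t in 𝓝 (0 : ℝ), u + t • h ∈ Set.Icc 0 1 := by
  have hcoord (i : ι) : ∀ᶠ t in 𝓝 (0 : ℝ), u i + t * h i ∈ Set.Icc (0 : ℝ) 1 := by
    by_cases hi : u i ∈ Set.Ioo (0 : ℝ) 1
    · have hcont : Continuous fun t : ℝ => u i + t * h i := by fun_prop
      exact hcont.continuousAt.eventually_mem
        (Icc_mem_nhds (by simpa using hi.1) (by simpa using hi.2))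
    · exact .of_forall fun t => by simpa [hh i hi] using And.intro (hu.1 i) (hu.2 i)
  filter_upwards [eventually_all.2 hcoord] with t ht
  exact ⟨fun i => (ht i).1, fun i => (ht i).2⟩

theorem card_fractional_le_finrank {ι F : Type*} [Fintype ι] [AddCommGroup F] [Module ℝ F]
    [FiniteDimensional ℝ F] {f : (ι → ℝ) →ₗ[ℝ] F} {b : F} {u : ι → ℝ}
    (hu : u ∈ (Set.Icc 0 1 ∩ f ⁻¹' {b}).extremePoints ℝ) :
    #{i | u i ∈ Set.Ioo (0 : ℝ) 1} ≤ finrank ℝ F := by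
  by_contra! hlt
  obtain ⟨h, hf, hne, hsupp⟩ := exists_map_eq_zero_of_finrank_lt_card f hlt
  have hmem : ∀ᶠ t in 𝓝 (0 : ℝ), u + t • h ∈ Set.Icc 0 1 ∩ f ⁻¹' {b} := by
    filter_upwards [eventually_add_smul_mem_Icc hu.1.1 fun i hi => hsupp i (by simpa using hi)]
      with t ht
    exact ⟨ht, by simpa [hf] using hu.1.2⟩
  obtain ⟨t, ⟨hpos, hneg⟩, ht : t ≠ 0⟩ :=
    (((hmem.and ((tendsto_neg (0 : ℝ)).eventually (by rwa [neg_zero]))).filter_mono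
      nhdsWithin_le_nhds).and (eventually_mem_nhdsWithin (s := {0}ᶜ))).exists
  have hmid : u ∈ openSegment ℝ (u + t • h) (u + -t • h) :=
    ⟨1 / 2, 1 / 2, by norm_num, by norm_num, by norm_num, by module⟩
  exact hne (by simpa [ht] using hu.2 hpos hneg hmid)

theorem exists_map_eq_card_fractional_le {ι F : Type*} [Fintype ι] [AddCommGroup F] [Module ℝ F]
    [FiniteDimensional ℝ F] (f : (ι → ℝ) →ₗ[ℝ] F) {w : ι → ℝ} (hw : w ∈ Set.Icc 0 1) :
    ∃ u ∈ Set.Icc 0 1, f u = f w ∧ #{i | u i ∈ Set.Ioo (0 : ℝ) 1} ≤ finrank ℝ F := by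
  have hclosed : IsClosed (f ⁻¹' {f w}) := by
    have heq : f ⁻¹' {f w} = (· - w) ⁻¹' (f.ker : Set (ι → ℝ)) := by
      ext u
      simp [sub_eq_zero]
    rw [heq]
    exact f.ker.closed_of_finiteDimensional.preimage (by fun_prop)
  obtain ⟨u, hu⟩ := (isCompact_Icc.inter_right hclosed).extremePoints_nonempty ⟨w, hw, rfl⟩
  exact ⟨u, hu.1.1, hu.1.2, card_fractional_le_finrank hu⟩

theorem exists_sum_eq_exists_eq_zero {ι E : Type*} [AddCommGroup E] [Module ℝ E]
    [FiniteDimensional ℝ E] {A : Finset ι} (v : ι → E) {w : ι → ℝ}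
    (hw : ∀ i ∈ A, w i ∈ Set.Icc (0 : ℝ) 1)
    (hsum : ∑ i ∈ A, w i + finrank ℝ E + 1 ≤ #A) :
    ∃ u : ι → ℝ, (∀ i ∈ A, u i ∈ Set.Icc (0 : ℝ) 1) ∧ ∑ i ∈ A, u i = ∑ i ∈ A, w i ∧
      ∑ i ∈ A, u i • v i = ∑ i ∈ A, w i • v i ∧ ∃ i ∈ A, u i = 0 := by
  classical
  obtain ⟨u, hu, huw, hcard⟩ := exists_map_eq_card_fractional_le
    (Fintype.linearCombination ℝ fun i : A => ((v i, 1) : E × ℝ)) (w := fun i => w i)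
    ⟨fun i => (hw i i.2).1, fun i => (hw i i.2).2⟩
  simp only [Fintype.linearCombination_apply, Prod.ext_iff, Prod.fst_sum, Prod.snd_sum,
    Prod.smul_mk, smul_eq_mul, mul_one] at huw
  obtain ⟨hv, h1⟩ := huw
  rw [A.sum_coe_sort w] at h1
  rw [A.sum_coe_sort fun i => w i • v i] at hv
  -- If no weight vanished, the at most `finrank ℝ E + 1` fractional weights, each short of `1` by
  -- less than `1`, would make up the whole defect `#A - ∑ w ≥ finrank ℝ E + 1`.
  obtain ⟨j, hj⟩ : ∃ j, u j = 0 := by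
    by_contra! hne
    set T : Finset A := {i | u i ∈ Set.Ioo (0 : ℝ) 1} with hT
    have hone : ∀ i ∉ T, 1 - u i = 0 := fun i hi => by
      have hpos := (hu.1 i).lt_of_ne' (hne i)
      have hge : 1 ≤ u i := not_lt.1 fun hlt => hi (by simpa [hT] using ⟨hpos, hlt⟩)
      exact sub_eq_zero.2 (hge.antisymm (hu.2 i))
    have hdefect : ∑ i ∈ T, (1 - u i) = #A - ∑ i ∈ A, w i := by
      rw [Finset.sum_subset T.subset_univ fun i _ => hone i, Finset.sum_sub_distrib, h1]
      simp
    have hTne : T.Nonempty := by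
      refine Finset.nonempty_of_sum_ne_zero (f := fun i => 1 - u i) ?_
      rw [hdefect]
      have : (0 : ℝ) ≤ finrank ℝ E := Nat.cast_nonneg _
      linarith
    have hlt : ∑ i ∈ T, (1 - u i) < #T := by
      simpa using Finset.sum_lt_sum_of_nonempty hTne fun i hi =>
        sub_lt_self (1 : ℝ) (Finset.mem_filter.1 hi).2.1
    have hle : (#T : ℝ) ≤ finrank ℝ E + 1 := by
      exact_mod_cast hcard.trans_eq (by simp)
    linarith
  refine ⟨fun i => if h : i ∈ A then u ⟨i, h⟩ else 0, fun i hi => ?_, ?_, ?_, j, j.2, by simp [hj]⟩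
  · simpa [hi] using And.intro (hu.1 ⟨i, hi⟩) (hu.2 ⟨i, hi⟩)
  · simp [← h1, ← A.sum_coe_sort]
  · simp [← hv, ← A.sum_coe_sort]

section Steinitz

variable {ι E : Type*} [NormedAddCommGroup E] {v : ι → E} {r : ℝ}

theorem norm_sum_map_le_length_mul {l : List ι} (hl : ∀ i ∈ l, ‖v i‖ ≤ r) :
    ‖(l.map v).sum‖ ≤ l.length * r := by
  calc ‖(l.map v).sum‖ ≤ ((l.map v).map norm).sum := by
        simpa using norm_multiset_sum_le (l.map v : Multiset E)
    _ ≤ l.length * r := by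
        simpa using ((l.map v).map norm).sum_le_card_nsmul r (by simpa using hl)

theorem exists_perm_norm_prefix_sum_le_of_card_le {A : Finset ι} (hr : 0 ≤ r)
    (hv : ∀ i ∈ A, ‖v i‖ ≤ r) {N : ℕ} (hA : #A ≤ N) :
    ∃ l, l ~ A.toList ∧ ∀ p, p <+: l → ‖(p.map v).sum‖ ≤ N * r := by
  refine ⟨A.toList, .rfl, fun p hp => ?_⟩
  refine (norm_sum_map_le_length_mul fun i hi => hv i (Finset.mem_toList.1 (hp.subset hi))).trans ?_
  gcongr
  exact hp.length_le.trans (A.length_toList.trans_le hA)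

variable [NormedSpace ℝ E]

theorem norm_sum_le_of_sum_smul_eq_zero {A : Finset ι} {w : ι → ℝ} (hv : ∀ i ∈ A, ‖v i‖ ≤ r)
    (hw : ∀ i ∈ A, w i ≤ 1) (hwv : ∑ i ∈ A, w i • v i = 0) :
    ‖∑ i ∈ A, v i‖ ≤ (#A - ∑ i ∈ A, w i) * r :=
  calc ‖∑ i ∈ A, v i‖ = ‖∑ i ∈ A, (1 - w i) • v i‖ := by simp [sub_smul, hwv]
    _ ≤ ∑ i ∈ A, (1 - w i) * r := norm_sum_le_of_le _ fun i hi => by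
      have h1 : 0 ≤ 1 - w i := sub_nonneg.2 (hw i hi)
      rw [norm_smul, Real.norm_of_nonneg h1]
      exact mul_le_mul_of_nonneg_left (hv i hi) h1
    _ = (#A - ∑ i ∈ A, w i) * r := by simp [← Finset.sum_mul]

variable [FiniteDimensional ℝ E]

/-- The induction behind the Steinitz lemma, after Grinberg and Sevastyanov: the weights, scaled to
have sum `N - 1`, can be replaced by ones of which at least one vanishes, and an index of vanishing
weight is put last. -/
theorem exists_perm_norm_prefix_sum_le_of_weights (hr : 0 ≤ r) (N : ℕ) {A : Finset ι}
    (hv : ∀ i ∈ A, ‖v i‖ ≤ r) (hA : #A = finrank ℝ E + N) {w : ι → ℝ}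
    (hw : ∀ i ∈ A, w i ∈ Set.Icc (0 : ℝ) 1) (hsum : ∑ i ∈ A, w i = N)
    (hwv : ∑ i ∈ A, w i • v i = 0) :
    ∃ l, l ~ A.toList ∧ ∀ p, p <+: l → ‖(p.map v).sum‖ ≤ finrank ℝ E * r := by
  classical
  induction N generalizing A w with
  | zero => exact exists_perm_norm_prefix_sum_le_of_card_le hr hv hA.le
  | succ N ih =>
    have hA' : (#A : ℝ) = finrank ℝ E + (N + 1) := by exact_mod_cast hA
    rw [Nat.cast_succ] at hsum
    set c : ℝ := N / (N + 1)
    have hc0 : 0 ≤ c := by positivity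
    have hc1 : c ≤ 1 := div_le_one_of_le₀ (by linarith) (by positivity)
    have hcN : c * (N + 1) = N := div_mul_cancel₀ _ (by positivity)
    obtain ⟨u, hu, husum, huv, j, hjA, hj⟩ := exists_sum_eq_exists_eq_zero (A := A) v
      (w := fun i => c * w i)
      (fun i hi => ⟨mul_nonneg hc0 (hw i hi).1, mul_le_one₀ hc1 (hw i hi).1 (hw i hi).2⟩)
      (by rw [← Finset.mul_sum, hsum, hA', hcN]; linarith)
    simp only [← Finset.mul_sum, hsum, hcN, mul_smul, ← Finset.smul_sum, hwv, smul_zero]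
      at husum huv
    obtain ⟨l, hl, hprefix⟩ := ih (A := A.erase j) (w := u)
      (fun i hi => hv i (Finset.mem_of_mem_erase hi))
      (by rw [Finset.card_erase_of_mem hjA, hA]; rfl)
      (fun i hi => hu i (Finset.mem_of_mem_erase hi))
      (by rw [Finset.sum_erase _ hj, husum])
      (by rw [Finset.sum_erase _ (by simp [hj]), huv])
    have hperm : l ++ [j] ~ A.toList := by
      have := Finset.toList_insert (Finset.notMem_erase j A)
      rw [Finset.insert_erase hjA] at this
      exact (List.perm_append_singleton j l).trans ((hl.cons j).trans this.symm)
    refine ⟨l ++ [j], hperm, fun p hp => ?_⟩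
    rcases List.prefix_concat_iff.1 hp with rfl | hp
    · rw [(hperm.map v).sum_eq, A.sum_map_toList]
      refine (norm_sum_le_of_sum_smul_eq_zero hv (fun i hi => (hw i hi).2) hwv).trans_eq ?_
      rw [hsum, hA', add_sub_cancel_right]
    · exact hprefix p hp

theorem exists_perm_norm_prefix_sum_le_of_sum_eq_zero {A : Finset ι} (hr : 0 ≤ r)
    (hv : ∀ i ∈ A, ‖v i‖ ≤ r) (hsum : ∑ i ∈ A, v i = 0) :
    ∃ l, l ~ A.toList ∧ ∀ p, p <+: l → ‖(p.map v).sum‖ ≤ finrank ℝ E * r := by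
  rcases le_or_gt #A (finrank ℝ E) with h | h
  · exact exists_perm_norm_prefix_sum_le_of_card_le hr hv h
  · obtain ⟨N, hN⟩ := Nat.exists_eq_add_of_le h.le
    have hc : (0 : ℝ) < #A := by exact_mod_cast Nat.zero_lt_of_lt h
    have hNA : (N : ℝ) ≤ #A := by exact_mod_cast hN ▸ Nat.le_add_left N _
    refine exists_perm_norm_prefix_sum_le_of_weights hr N hv hN (w := fun _ => N / #A)
      (fun i _ => ⟨by positivity, (div_le_one hc).2 hNA⟩) ?_ ?_
    · rw [Finset.sum_const, nsmul_eq_mul, mul_div_cancel₀ _ hc.ne']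
    · rw [← Finset.smul_sum, hsum, smul_zero]

theorem exists_perm_norm_prefix_sum_le {A : Finset ι} (hr : 0 ≤ r) (hv : ∀ i ∈ A, ‖v i‖ ≤ r) :
    ∃ l, l ~ A.toList ∧
      ∀ p, p <+: l → ‖(p.map v).sum‖ ≤ 2 * finrank ℝ E * r + ‖∑ i ∈ A, v i‖ := by
  rcases A.eq_empty_or_nonempty with rfl | hA
  · refine ⟨[], by simp, fun p hp => ?_⟩
    rw [List.prefix_nil.1 hp, List.map_nil, List.sum_nil, norm_zero]
    positivity
  have hc : (0 : ℝ) < #A := by exact_mod_cast hA.card_pos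
  set a : E := (#A : ℝ)⁻¹ • ∑ i ∈ A, v i with ha
  have hcard : #A * ‖a‖ = ‖∑ i ∈ A, v i‖ := by
    rw [ha, norm_smul, norm_inv, Real.norm_of_nonneg hc.le, mul_inv_cancel_left₀ hc.ne']
  have har : ‖a‖ ≤ r := by
    refine le_of_mul_le_mul_left (hcard.trans_le ?_) hc
    simpa using norm_sum_le_of_le A hv
  obtain ⟨l, hl, hprefix⟩ := exists_perm_norm_prefix_sum_le_of_sum_eq_zero
    (v := fun i => v i - a) (by positivity : 0 ≤ 2 * r)
    (fun i hi => (norm_sub_le _ _).trans (by linarith [hv i hi]))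
    (by rw [Finset.sum_sub_distrib, Finset.sum_const, ha, ← Nat.cast_smul_eq_nsmul ℝ,
      smul_inv_smul₀ hc.ne', sub_self])
  refine ⟨l, hl, fun p hp => ?_⟩
  have hsplit : (p.map v).sum = (p.map fun i => v i - a).sum + p.length • a := by
    have := List.sum_map_add (l := p) (f := fun i => v i - a) (g := fun _ => a)
    simpa using this
  calc ‖(p.map v).sum‖ ≤ ‖(p.map fun i => v i - a).sum‖ + p.length * ‖a‖ := by
        rw [hsplit]
        exact norm_add_le_of_le le_rfl (norm_nsmul_le)
    _ ≤ finrank ℝ E * (2 * r) + #A * ‖a‖ := by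
        gcongr
        · exact hprefix p hp
        · exact hp.length_le.trans_eq (hl.length_eq.trans A.length_toList)
    _ = 2 * finrank ℝ E * r + ‖∑ i ∈ A, v i‖ := by rw [hcard]; ring

end Steinitz

section Connectedness

theorem isPreconnected_union_of_connectedComponentIn_inter_nonempty {α : Type*}
    [TopologicalSpace α] {s t : Set α} (ht : IsPreconnected t)
    (hst : ∀ a ∈ s, (connectedComponentIn s a ∩ t).Nonempty) : IsPreconnected (s ∪ t) := by
  rcases t.eq_empty_or_nonempty with rfl | ⟨z, hz⟩
  · have hs : s = ∅ := Set.eq_empty_of_forall_notMem fun a ha => by simpa using hst a ha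
    simpa [hs] using ht
  refine isPreconnected_of_forall z ?_
  rintro a (ha | ha)
  · obtain ⟨b, hbs, hbt⟩ := hst a ha
    exact ⟨connectedComponentIn s a ∪ t,
      Set.union_subset_union_left t (connectedComponentIn_subset s a), .inr hz,
      .inl (mem_connectedComponentIn ha), isPreconnected_connectedComponentIn.union b hbs hbt ht⟩
  · exact ⟨t, Set.subset_union_right, hz, ha, ht⟩

theorem isPreconnected_compl_ball {E : Type*} [NormedAddCommGroup E] [NormedSpace ℝ E]
    (hE : 1 < Module.rank ℝ E) (c : E) (r : ℝ) : IsPreconnected (Metric.ball c r)ᶜ := by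
  rcases le_or_gt r 0 with hr | hr
  · simpa [Metric.ball_eq_empty.2 hr] using isPreconnected_univ
  -- The radial retraction of the punctured space onto the complement of the ball.
  let retract : E → E := fun z => c + (max r ‖z - c‖ / ‖z - c‖) • (z - c)
  have hnorm {z : E} (hz : z ≠ c) : ‖z - c‖ ≠ 0 := norm_ne_zero_iff.2 (sub_ne_zero.2 hz)
  have himage : (Metric.ball c r)ᶜ = retract '' {c}ᶜ := by
    refine Set.Subset.antisymm (fun z hz => ?_) ?_
    · have hrz : r ≤ ‖z - c‖ := by simpa [dist_eq_norm] using hz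
      have hzc : z ≠ c := by
        rintro rfl
        simp [hr] at hz
      exact ⟨z, hzc, by simp [retract, max_eq_right hrz, div_self (hnorm hzc)]⟩
    · rintro _ ⟨z, hz, rfl⟩
      have : dist (retract z) c = max r ‖z - c‖ := by
        have hmax : 0 ≤ max r ‖z - c‖ := le_max_of_le_left hr.le
        rw [dist_eq_norm, add_sub_cancel_left, norm_smul, norm_div, norm_norm,
          Real.norm_of_nonneg hmax, div_mul_cancel₀ _ (hnorm hz)]
      simp [this]
  rw [himage]
  refine (isConnected_compl_singleton_of_one_lt_rank hE c).isPreconnected.image _ ?_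
  have : ∀ z ∈ ({c}ᶜ : Set E), ‖z - c‖ ≠ 0 := fun z hz => hnorm hz
  fun_prop (disch := assumption)

theorem isPreconnected_union_compl_ball {E : Type*} [NormedAddCommGroup E] [NormedSpace ℝ E]
    (hE : 1 < Module.rank ℝ E) {X : Set E}
    (hX : ∀ a ∈ X, ¬ Bornology.IsBounded (connectedComponentIn X a)) (c : E) (r : ℝ) :
    IsPreconnected (X ∪ (Metric.ball c r)ᶜ) := by
  refine isPreconnected_union_of_connectedComponentIn_inter_nonempty
    (isPreconnected_compl_ball hE c r) fun a ha => ?_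
  exact Set.inter_compl_nonempty_iff.2 fun hsub => hX a ha (Metric.isBounded_ball.subset hsub)

theorem iInter_union_compl_ball_natCast {α : Type*} [PseudoMetricSpace α] (X : Set α) (c : α) :
    ⋂ n : ℕ, (X ∪ (Metric.ball c n)ᶜ) = X := by
  rw [← Set.union_iInter, ← Set.compl_iUnion, Metric.iUnion_ball_nat, Set.compl_univ,
    Set.union_empty]

end Connectedness

theorem exists_seq_mem_mapClusterPt_of_mem_iInter {α : Type*} [TopologicalSpace α]
    [SecondCountableTopology α] {Y : ℕ → Set α} (hY : ∀ n, (Y n).Nonempty) :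
    ∃ t : ℕ → α, (∀ n, t n ∈ Y n) ∧ ∀ p ∈ ⋂ n, Y n, MapClusterPt p atTop t := by
  rcases (⋂ n, Y n).eq_empty_or_nonempty with hempty | hne
  · choose t ht using hY
    exact ⟨t, ht, by simp [hempty]⟩
  have := hne.to_subtype
  let d := TopologicalSpace.denseSeq (⋂ n, Y n)
  -- The first component of `Nat.unpair` takes every value infinitely often.
  refine ⟨fun n => d n.unpair.1, fun n => Set.mem_iInter.1 (d n.unpair.1).2 n, fun p hp => ?_⟩
  refine mapClusterPt_iff_frequently.2 fun U hU => frequently_atTop.2 fun N => ?_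
  obtain ⟨j, hj⟩ := (TopologicalSpace.denseRange_denseSeq (⋂ n, Y n)).exists_mem_open
    (isOpen_interior.preimage continuous_subtype_val) ⟨⟨p, hp⟩, mem_interior_iff_mem_nhds.2 hU⟩
  exact ⟨Nat.pair j N, Nat.right_le_pair j N, by simpa [d] using interior_subset hj⟩

section SumRange

variable {E : Type*} [AddCommGroup E] [TopologicalSpace E] {x : ℕ → E} {q : E}

theorem tendsto_zero_of_mem_sumRange [IsTopologicalAddGroup E] (hq : q ∈ sumRange x) :
    Tendsto x cofinite (𝓝 0) := by
  obtain ⟨σ, hσ⟩ := hq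
  have hterm : Tendsto (fun n => x (σ n)) cofinite (𝓝 0) := by
    rw [Nat.cofinite_eq_atTop, ← sub_self q]
    refine ((hσ.comp (tendsto_add_atTop_nat 1)).sub hσ).congr fun n => ?_
    simp [seriesPartialSum, Finset.sum_range_succ]
  simpa [Function.comp_def] using hterm.comp σ.symm.injective.tendsto_cofinite

theorem mapClusterPt_sum_of_mem_sumRange (hq : q ∈ sumRange x) :
    MapClusterPt q atTop fun G : Finset ℕ => ∑ i ∈ G, x i := by
  obtain ⟨σ, hσ⟩ := hq
  have himage : Tendsto (fun k => (Finset.range k).map σ.toEmbedding) atTop atTop := by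
    refine tendsto_atTop_finset_of_monotone (fun a b hab => ?_) fun i => ⟨σ.symm i + 1, by simp⟩
    exact Finset.map_subset_map.2 (Finset.range_mono hab)
  refine .of_comp himage (Tendsto.mapClusterPt ?_)
  exact hσ.congr fun k => by simp [seriesPartialSum]

end SumRange

theorem exists_equiv_map_range_eq_of_prefix {ι : Type*} {L : ℕ → List ι}
    (hL : ∀ n, L n <+: L (n + 1)) (hnodup : ∀ n, (L n).Nodup) (hmem : ∀ i, ∃ n, i ∈ L n)
    (hlen : ∀ k, ∃ n, k < (L n).length) :
    ∃ σ : ℕ ≃ ι, ∀ n, (List.range (L n).length).map σ = L n := by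
  have hmono {a b : ℕ} (hab : a ≤ b) : L a <+: L b :=
    Nat.le_induction (List.prefix_refl _) (fun n _ ih => ih.trans (hL n)) b hab
  choose N hN using hlen
  let s : ℕ → ι := fun k => (L (N k))[k]'(hN k)
  have hs {n k : ℕ} (hk : k < (L n).length) : s k = (L n)[k] := by
    rcases le_total n (N k) with h | h
    · exact ((hmono h).getElem hk).symm
    · exact (hmono h).getElem (hN k)
  have hbij : Function.Bijective s := by
    refine ⟨fun a b hab => ?_, fun i => ?_⟩
    · have ha := (hN a).trans_le (hmono (le_max_left (N a) (N b))).length_le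
      have hb := (hN b).trans_le (hmono (le_max_right (N a) (N b))).length_le
      rw [hs ha, hs hb] at hab
      exact (hnodup _).getElem_inj_iff.1 hab
    · obtain ⟨n, hn⟩ := hmem i
      obtain ⟨k, hk, hki⟩ := List.getElem_of_mem hn
      exact ⟨k, (hs hk).trans hki⟩
  refine ⟨Equiv.ofBijective s hbij, fun n => List.ext_getElem (by simp) fun k _ hk => ?_⟩
  simpa using hs hk

section Stages

variable {ι E : Type*} [NormedAddCommGroup E] {x : ι → E}

/-- `L` extends `l`, and all sums of `x` over initial segments of `L` containing `l` lie in `s`: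
the stretch of a rearranged series that comes after `l` and ends with `L` does not leave `s`. -/
structure ExtendsWithin (x : ι → E) (s : Set E) (l L : List ι) : Prop where
  isPrefix : l <+: L
  sum_mem : ∀ p, l <+: p → p <+: L → (p.map x).sum ∈ s

theorem ExtendsWithin.mono {s t : Set E} {l L : List ι} (h : ExtendsWithin x s l L) (hst : s ⊆ t) :
    ExtendsWithin x t l L :=
  ⟨h.isPrefix, fun p hlp hpL => hst (h.sum_mem p hlp hpL)⟩

theorem ExtendsWithin.trans {s : Set E} {l₁ l₂ l₃ : List ι} (h₁₂ : ExtendsWithin x s l₁ l₂)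
    (h₂₃ : ExtendsWithin x s l₂ l₃) : ExtendsWithin x s l₁ l₃ := by
  refine ⟨h₁₂.isPrefix.trans h₂₃.isPrefix, fun p h₁ h₃ => ?_⟩
  rcases List.prefix_or_prefix_of_prefix h₂₃.isPrefix h₃ with h₂ | h₂
  · exact h₂₃.sum_mem p h₂ h₃
  · exact h₁₂.sum_mem p h₁ h₂

theorem ExtendsWithin.of_forall_succ {s : Set E} {L : ℕ → List ι} {M n : ℕ}
    (hL : ∀ k ≥ M, ExtendsWithin x s (L k) (L (k + 1))) (hn : M < n) :
    ExtendsWithin x s (L M) (L n) := by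
  induction n, hn using Nat.le_induction with
  | base => exact hL M le_rfl
  | succ n hn ih => exact ih.trans (hL n (Nat.le_of_succ_le hn))

/-- A finite list of indices from which a rearrangement can be continued at scale `ε`: it has used
up all terms of norm exceeding `ε`, and its sum is within `ε` of the current target `a`. -/
structure IsStage (x : ι → E) (ε : ℝ) (a : E) (l : List ι) : Prop where
  nodup : l.Nodup
  mem_of_lt_norm : ∀ i, ε < ‖x i‖ → i ∈ l
  dist_le : dist (l.map x).sum a ≤ ε

theorem exists_finset_forall_perm_isStage (hx0 : Tendsto x cofinite (𝓝 0)) {q : E}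
    (hx : MapClusterPt q atTop fun G : Finset ι => ∑ i ∈ G, x i) (D : Finset ι) {δ : ℝ}
    (hδ : 0 < δ) : ∃ G, D ⊆ G ∧ ∀ l, l ~ G.toList → IsStage x δ q l := by
  classical
  have hlarge : {i | δ < ‖x i‖}.Finite := by
    have := hx0.norm.eventually_le_const (by simpa using hδ)
    simpa using this
  obtain ⟨G, hG, hDG⟩ := ((hx.frequently (Metric.closedBall_mem_nhds q hδ)).and_eventually
    (eventually_ge_atTop (D ∪ hlarge.toFinset))).exists
  obtain ⟨hD, hlargeG⟩ := Finset.union_subset_iff.1 hDG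
  refine ⟨G, hD, fun l hl => ⟨hl.nodup_iff.2 G.nodup_toList, fun i hi => ?_, ?_⟩⟩
  · exact hl.mem_iff.2 (Finset.mem_toList.2 (hlargeG (hlarge.mem_toFinset.2 hi)))
  · rwa [(hl.map x).sum_eq, G.sum_map_toList]

theorem append_perm_toList_of_perm_sdiff [DecidableEq ι] {l m : List ι} {G : Finset ι}
    (hl : l.Nodup) (hlG : l.toFinset ⊆ G) (hm : m ~ (G \ l.toFinset).toList) :
    l ++ m ~ G.toList := by
  have hdisj : l.Disjoint m := fun i hil him => by
    simpa [hil] using hm.mem_iff.1 him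
  refine (List.perm_ext_iff_of_nodup (hl.append (hm.nodup_iff.2 (Finset.nodup_toList _)) hdisj)
    G.nodup_toList).2 fun i => ?_
  rw [List.mem_append, hm.mem_iff]
  by_cases hi : i ∈ l
  · simp [hi, hlG (List.mem_toFinset.2 hi)]
  · simp [hi]

theorem IsStage.mono {ε δ : ℝ} {a : E} {l : List ι} (h : IsStage x ε a l) (hεδ : ε ≤ δ) :
    IsStage x δ a l :=
  ⟨h.nodup, fun i hi => h.mem_of_lt_norm i (hεδ.trans_lt hi), h.dist_le.trans hεδ⟩

variable [NormedSpace ℝ E] [FiniteDimensional ℝ E]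

theorem exists_isStage_extendsWithin_closedBall (hx0 : Tendsto x cofinite (𝓝 0)) {p q : E}
    (hx : MapClusterPt q atTop fun G : Finset ι => ∑ i ∈ G, x i) {ε δ : ℝ} (hε : 0 < ε)
    (hδ : 0 < δ) {l : List ι} (hl : IsStage x ε p l) (hpq : dist p q ≤ ε) (D : List ι) :
    ∃ L, IsStage x δ q L ∧ D ⊆ L ∧
      ExtendsWithin x (Metric.closedBall q ((2 * finrank ℝ E + 5) * ε)) l L := by
  classical
  obtain ⟨G, hDG, hG⟩ := exists_finset_forall_perm_isStage hx0 hx (D.toFinset ∪ l.toFinset)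
    (lt_min hδ hε)
  obtain ⟨hDG, hlG⟩ := Finset.union_subset_iff.1 hDG
  obtain ⟨m, hm, hprefix⟩ := exists_perm_norm_prefix_sum_le (A := G \ l.toFinset) (v := x) hε.le
    fun i hi => not_lt.1 fun hlt => (Finset.mem_sdiff.1 hi).2
      (List.mem_toFinset.2 (hl.mem_of_lt_norm i hlt))
  have hL := append_perm_toList_of_perm_sdiff hl.nodup hlG hm
  have hstage := hG _ hL
  have hlq : dist (l.map x).sum q ≤ 2 * ε :=
    (dist_triangle _ p q).trans (by linarith [hl.dist_le])
  have hmsum : ‖∑ i ∈ G \ l.toFinset, x i‖ ≤ 3 * ε := by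
    rw [← Finset.sum_map_toList, ← (hm.map x).sum_eq]
    have hsplit : (m.map x).sum = ((l ++ m).map x).sum - (l.map x).sum := by simp
    rw [hsplit, ← dist_eq_norm]
    have hLq := hstage.dist_le.trans (min_le_right δ ε)
    linarith [dist_triangle_right ((l ++ m).map x).sum (l.map x).sum q]
  refine ⟨l ++ m, hstage.mono (min_le_left δ ε), fun i hi => ?_, List.prefix_append l m, ?_⟩
  · exact hL.mem_iff.2 (Finset.mem_toList.2 (hDG (List.mem_toFinset.2 hi)))
  · rintro _ ⟨p, rfl⟩ hpm
    have hp := hprefix p ((List.prefix_append_right_inj l).1 hpm)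
    rw [mem_closedBall_iff_norm, List.map_append, List.sum_append, add_sub_right_comm]
    rw [dist_eq_norm] at hlq
    linarith [norm_add_le ((l.map x).sum - q) (p.map x).sum]

theorem exists_isStage_extendsWithin_cthickening (hx0 : Tendsto x cofinite (𝓝 0))
    (hx : ∀ q, MapClusterPt q atTop fun G : Finset ι => ∑ i ∈ G, x i) {Y : Set E}
    (hY : IsPreconnected Y) {a b : E} (ha : a ∈ Y) (hb : b ∈ Y) {ε δ : ℝ} (hε : 0 < ε)
    (hδ : 0 < δ) {l : List ι} (hl : IsStage x ε a l) (D : List ι) :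
    ∃ L, IsStage x δ b L ∧ D ⊆ L ∧
      ExtendsWithin x (Metric.cthickening ((2 * finrank ℝ E + 5) * ε) Y) l L := by
  have hstep {p q : E} (hq : q ∈ Y) (hpq : dist p q ≤ ε) {η : ℝ} (hη : 0 < η) (D : List ι)
      {l : List ι} (hl : IsStage x ε p l) : ∃ L, IsStage x η q L ∧ D ⊆ L ∧
        ExtendsWithin x (Metric.cthickening ((2 * finrank ℝ E + 5) * ε) Y) l L := by
    obtain ⟨L, hL, hDL, hlL⟩ :=
      exists_isStage_extendsWithin_closedBall hx0 (hx q) hε hη hl hpq D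
    exact ⟨L, hL, hDL, hlL.mono (Metric.closedBall_subset_cthickening hq _)⟩
  let Reaches (p q : E) : Prop := ∀ l, IsStage x ε p l → ∃ L, IsStage x ε q L ∧
    ExtendsWithin x (Metric.cthickening ((2 * finrank ℝ E + 5) * ε) Y) l L
  have hnear {p q : E} (hq : q ∈ Y) (hpq : dist p q ≤ ε) : Reaches p q := fun l hl => by
    obtain ⟨L, hL, -, hlL⟩ := hstep hq hpq hε [] hl
    exact ⟨L, hL, hlL⟩
  have hab : Reaches a b := by
    refine hY.induction₂' Reaches (fun p hp => ?_) (fun p q r _ _ _ hpq hqr l hl => ?_) ha hb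
    · filter_upwards [self_mem_nhdsWithin,
        mem_nhdsWithin_of_mem_nhds (Metric.closedBall_mem_nhds p hε)] with q hq hqp
      exact ⟨hnear hq (Metric.mem_closedBall'.1 hqp), hnear hp hqp⟩
    · obtain ⟨L, hL, hlL⟩ := hpq l hl
      obtain ⟨L', hL', hLL'⟩ := hqr L hL
      exact ⟨L', hL', hlL.trans hLL'⟩
  obtain ⟨L, hL, hlL⟩ := hab l hl
  obtain ⟨L', hL', hDL', hLL'⟩ := hstep hb (by simpa using hε.le) hδ D hL
  exact ⟨L', hL', hDL', hlL.trans hLL'⟩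

end Stages

section Rearrangement

variable {E : Type*} [NormedAddCommGroup E] [NormedSpace ℝ E] [FiniteDimensional ℝ E] {x : ℕ → E}
  {Y : ℕ → Set E} {t : ℕ → E}

theorem exists_seq_isStage (hx0 : Tendsto x cofinite (𝓝 0))
    (hx : ∀ q, MapClusterPt q atTop fun G : Finset ℕ => ∑ i ∈ G, x i)
    (hanti : Antitone Y) (hY : ∀ n, IsPreconnected (Y n)) (ht : ∀ n, t n ∈ Y n) {ε : ℕ → ℝ}
    (hε : ∀ n, 0 < ε n) :
    ∃ L : ℕ → List ℕ, (∀ n, IsStage x (ε n) (t n) (L n)) ∧ (∀ n, List.range n ⊆ L n) ∧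
      ∀ n, ExtendsWithin x (Metric.cthickening ((2 * finrank ℝ E + 5) * ε n) (Y n))
        (L n) (L (n + 1)) := by
  obtain ⟨G, -, hG⟩ := exists_finset_forall_perm_isStage hx0 (hx (t 0)) ∅ (hε 0)
  have hnext (n : ℕ) (l : {l // IsStage x (ε n) (t n) l}) :=
    exists_isStage_extendsWithin_cthickening hx0 hx (hY n) (ht n)
      (hanti n.le_succ (ht (n + 1))) (hε n) (hε (n + 1)) l.2 (List.range (n + 1))
  choose next hstage hrange hext using hnext
  let L (n : ℕ) : {l // IsStage x (ε n) (t n) l} :=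
    Nat.rec ⟨G.toList, hG _ .rfl⟩ (fun n l => ⟨next n l, hstage n l⟩) n
  refine ⟨fun n => (L n).1, fun n => (L n).2, fun n => ?_, fun n => hext n (L n)⟩
  cases n with
  | zero => simp
  | succ n => exact hrange n (L n)

theorem exists_perm_seriesPartialSum_follow (hx0 : Tendsto x cofinite (𝓝 0))
    (hx : ∀ q, MapClusterPt q atTop fun G : Finset ℕ => ∑ i ∈ G, x i)
    (hanti : Antitone Y) (hY : ∀ n, IsPreconnected (Y n)) (ht : ∀ n, t n ∈ Y n) :
    ∃ (σ : Equiv.Perm ℕ) (K : ℕ → ℕ), Tendsto K atTop atTop ∧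
      Tendsto (fun n => dist (t n) (seriesPartialSum (fun i => x (σ i)) (K n))) atTop (𝓝 0) ∧
      ∀ N, ∀ δ > 0,
        ∀ᶠ k in atTop, seriesPartialSum (fun i => x (σ i)) k ∈ Metric.cthickening δ (Y N) := by
  obtain ⟨L, hstage, hrange, hext⟩ := exists_seq_isStage hx0 hx hanti hY ht
    (ε := fun n => 1 / ((n : ℝ) + 1)) fun n => Nat.one_div_pos_of_nat
  have hlen (n : ℕ) : n ≤ (L n).length := by
    simpa using (List.nodup_range.subperm (hrange n)).length_le
  obtain ⟨σ, hσ⟩ := exists_equiv_map_range_eq_of_prefix (fun n => (hext n).isPrefix)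
    (fun n => (hstage n).nodup) (fun i => ⟨i + 1, hrange _ (by simp)⟩) fun k => ⟨k + 1, hlen _⟩
  have hsum (k : ℕ) :
      (((List.range k).map σ).map x).sum = seriesPartialSum (fun i => x (σ i)) k := by
    rw [List.map_map]
    rfl
  have hprefix {a b : ℕ} (hab : a ≤ b) : (List.range a).map σ <+: (List.range b).map σ := by
    simpa [hab] using ((List.range b).take_prefix a).map σ
  refine ⟨σ, fun n => (L n).length, tendsto_atTop_mono hlen tendsto_id, ?_, fun N δ hδ => ?_⟩
  · refine squeeze_zero (fun _ => dist_nonneg) (fun n => ?_) tendsto_one_div_add_atTop_nhds_zero_nat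
    rw [← hsum, hσ, dist_comm]
    exact (hstage n).dist_le
  · have hsmall : ∀ᶠ n : ℕ in atTop, (2 * finrank ℝ E + 5) * (1 / ((n : ℝ) + 1)) ≤ δ := by
      refine Tendsto.eventually_le_const hδ ?_
      simpa using tendsto_one_div_add_atTop_nhds_zero_nat.const_mul (2 * (finrank ℝ E : ℝ) + 5)
    obtain ⟨M, hM⟩ := eventually_atTop.1 (hsmall.and (eventually_ge_atTop N))
    have hstay : ∀ n ≥ M, ExtendsWithin x (Metric.cthickening δ (Y N)) (L n) (L (n + 1)) :=
      fun n hn => (hext n).mono <| (Metric.cthickening_mono (hM n hn).1 _).trans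
        (Metric.cthickening_subset_of_subset δ (hanti (hM n hn).2))
    filter_upwards [eventually_ge_atTop (L M).length] with k hk
    have hMk : M < max (M + 1) k := by omega
    rw [← hsum]
    refine (ExtendsWithin.of_forall_succ hstay hMk).sum_mem _ ?_ ?_
    · rw [← hσ M]
      exact hprefix hk
    · rw [← hσ (max (M + 1) k)]
      exact hprefix ((le_max_right _ _).trans (hlen _))

theorem exists_perm_limitSet_eq_iInter (hx0 : Tendsto x cofinite (𝓝 0))
    (hx : ∀ q, MapClusterPt q atTop fun G : Finset ℕ => ∑ i ∈ G, x i)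
    (hanti : Antitone Y) (hclosed : ∀ n, IsClosed (Y n)) (hY : ∀ n, IsConnected (Y n)) :
    ∃ σ : Equiv.Perm ℕ, limitSet (fun n => x (σ n)) = ⋂ n, Y n := by
  obtain ⟨t, ht, hcluster⟩ := exists_seq_mem_mapClusterPt_of_mem_iInter fun n => (hY n).nonempty
  obtain ⟨σ, K, hK, hKt, hnear⟩ :=
    exists_perm_seriesPartialSum_follow hx0 hx hanti (fun n => (hY n).isPreconnected) ht
  refine ⟨σ, Set.Subset.antisymm (fun p hp => Set.mem_iInter.2 fun n => ?_) fun p hp => ?_⟩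
  · rw [← (hclosed n).closure_eq, Metric.closure_eq_iInter_cthickening]
    exact Set.mem_iInter₂.2 fun δ hδ =>
      Metric.isClosed_cthickening.mem_of_mapClusterPt hp (hnear n δ hδ)
  · obtain ⟨φ, hφ, hlim⟩ := (hcluster p hp).tendsto_subseq
    have hφK : Tendsto (fun j => seriesPartialSum (fun n => x (σ n)) (K (φ j))) atTop (𝓝 p) :=
      hlim.congr_dist (hKt.comp hφ.tendsto_atTop)
    exact .of_comp (hK.comp hφ.tendsto_atTop) hφK.mapClusterPt

theorem corollary6p6_general (hE : 1 < Module.rank ℝ E) (hx0 : Tendsto x cofinite (𝓝 0))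
    (hx : ∀ q, MapClusterPt q atTop fun G : Finset ℕ => ∑ i ∈ G, x i) {X : Set E}
    (hX : IsClosed X) (hcomp : ∀ a ∈ X, ¬ Bornology.IsBounded (connectedComponentIn X a)) :
    ∃ σ : Equiv.Perm ℕ, X = limitSet (fun n => x (σ n)) := by
  have : Nontrivial E := rank_pos_iff_nontrivial.1 (zero_lt_one.trans hE)
  let Y (n : ℕ) : Set E := X ∪ (Metric.ball 0 n)ᶜ
  have hanti : Antitone Y := fun k n hkn => Set.union_subset_union_right X <|
    Set.compl_subset_compl.2 (Metric.ball_subset_ball (Nat.cast_le.2 hkn))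
  have hclosed (n : ℕ) : IsClosed (Y n) := hX.union Metric.isOpen_ball.isClosed_compl
  have hne (n : ℕ) : (Y n).Nonempty := by
    obtain ⟨z, hz⟩ := NormedSpace.exists_lt_norm ℝ E n
    exact ⟨z, .inr (by simpa using hz.le)⟩
  obtain ⟨σ, hσ⟩ := exists_perm_limitSet_eq_iInter hx0 hx hanti hclosed fun n =>
    ⟨hne n, isPreconnected_union_compl_ball hE hcomp 0 n⟩
  exact ⟨σ, (hσ.trans (iInter_union_compl_ball_natCast X 0)).symm⟩

end Rearrangement

theorem corollary6p6 (m : ℕ) (hm : 2 ≤ m) (x : ℕ → EuclideanSpace ℝ (Fin m))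
    (hx : sumRange x = Set.univ) (X : Set (EuclideanSpace ℝ (Fin m))) (hX : IsClosed X)
    (hcomp : ∀ a ∈ X, ¬ Bornology.IsBounded (connectedComponentIn X a)) :
    ∃ σ : Equiv.Perm ℕ, X = limitSet (fun n => x (σ n)) := by
  refine corollary6p6_general ?_ (tendsto_zero_of_mem_sumRange (hx ▸ Set.mem_univ 0))
    (fun q => mapClusterPt_sum_of_mem_sumRange (hx ▸ Set.mem_univ q)) hX hcomp
  simpa [← Module.finrank_eq_rank, Nat.succ_le_iff] using hm
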